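/- Let $X$ be a real reflexive Banach space with dual $X^*$ and pairing $\langle\cdot,\cdot\rangle$. For a set-valued operator $A:X\rightrightarrows X^*$ with graph $\operatorname{gra}A=\{(x,x^*): x^*\in Ax\}$ and for $n\in\{2,3,\dots\}$, the Fitzpatrick function of $A$ of order $n$ is $$F_{A,n}(x,x^*)=\sup_{(a_1,a_1^*),\dots,(a_{n-1},a_{n-1}^*)\in\operatorname{gra}A}\Big(\langle x,x^*\rangle+\sum_{i=1}^{n-2}\langle a_{i+1}-a_i,a_i^*\rangle+\langle x-a_{n-1},a_{n-1}^*\rangle+\langle a_1-x,x^*\rangle\Big),$$ and $F_{A,\infty}=\sup_{n\ge 2}F_{A,n}$. For functions $f:X\to\,]-\infty,+\infty]$ and $g:X^*\to\,]-\infty,+\infty]$ write $f^*(x^*)=\sup_{x\in X}(\langle x,x^*\rangle-f(x))$ for the Fenchel conjugate and $(f\oplus g)(x,x^*)=f(x)+g(x^*)$. Let $A:X\to X^*$ be a linear (single-valued, everywhere defined) operator that is maximal monotone and symmetric, that is, $\langle Ax,y\rangle=\langle Ay,x\rangle$ for all $x,y\in X$; here maximal monotone means that $A$ is monotone, i.e.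 $\langle x-y,Ax-Ay\rangle\ge 0$ for all $x,y\in X$, and that its graph is not properly contained in the graph of any monotone set-valued operator $X\rightrightarrows X^*$. Put $q_A(x)=\tfrac12\langle x,Ax\rangle$. Then for every $n\in\{2,3,\dots\}$ and every $(x,x^*)\in X\times X^*$, $$F_{A,n}(x,x^*)=\tfrac{n-1}{n}q_A(x)+\tfrac{n-1}{n}q_A^*(x^*)+\tfrac1n\langle x,x^*\rangle,$$ and $$F_{A,\infty}=q_A\oplus q_A^*.$$ If $X$ is a real Hilbert space, with $X$ identified with $X^*$ through the Riesz isomorphism so that the identity $\mathrm{Id}$ is an operator $X\to X^*$, then for every $n\in\{2,3,\dots\}$ and every $(x,x^*)\in X\times X^*$, $$F_{\mathrm{Id},n}(x,x^*)=\tfrac{n-1}{2n}\|x\|^2+\tfrac{n-1}{2n}\|x^*\|^2+\tfrac1n\langle x,x^*\rangle,$$ and $$F_{\mathrm{Id},\infty}=\tfrac12\|\cdot\|^2\oplus\tfrac12\|\cdot\|^2.$$ -/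

import Mathlib

noncomputable section

namespace FitzpatrickOrder

variable {X : Type*} [NormedAddCommGroup X] [NormedSpace ℝ X]

/-- A real normed space is reflexive if the canonical isometric embedding into its bidual is
onto. -/
def IsReflexive (X : Type*) [NormedAddCommGroup X] [NormedSpace ℝ X] : Prop :=
  Function.Surjective (NormedSpace.inclusionInDoubleDual ℝ X)

/-- The graph of a set-valued operator `A : X ⇉ X*`. -/
def gra (A : X → Set (StrongDual ℝ X)) : Set (X × StrongDual ℝ X) :=
  {p | p.2 ∈ A p.1}

/-- A single-valued mapping with full domain, seen as a set-valued operator. -/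
def ofMap (T : X → StrongDual ℝ X) : X → Set (StrongDual ℝ X) :=
  fun x => {T x}

/-- Monotonicity: `⟨x - y, x* - y*⟩ ≥ 0` for all `(x, x*)`, `(y, y*)` in the graph. -/
def IsMonotone (A : X → Set (StrongDual ℝ X)) : Prop :=
  ∀ p ∈ gra A, ∀ q ∈ gra A, 0 ≤ (p.2 - q.2) (p.1 - q.1)

/-- Maximal monotonicity: monotone, without a proper monotone extension (among all set-valued
operators). -/
def IsMaximalMonotone (A : X → Set (StrongDual ℝ X)) : Prop :=
  IsMonotone A ∧
    ∀ B : X → Set (StrongDual ℝ X), IsMonotone B → gra A ⊆ gra B → gra B = gra A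

/-- Symmetry: `⟨Ax, y⟩ = ⟨Ay, x⟩` for all `x, y ∈ dom A`. -/
def IsSymmetric (A : X → Set (StrongDual ℝ X)) : Prop :=
  ∀ p ∈ gra A, ∀ q ∈ gra A, p.2 q.1 = q.2 p.1

/-- The quadratic form `q_A`: `q_A x = ½⟨x, Ax⟩` if `x ∈ dom A`, and `+∞` otherwise.
For a monotone linear relation `A` the number `⟨x, x*⟩` is the same for all `x* ∈ A x`, so that the
infimum below only selects this common value; it is `⊤` when `A x` is empty. -/
def quad (A : X → Set (StrongDual ℝ X)) (x : X) : EReal :=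
  ⨅ x' ∈ A x, (((1 / 2 : ℝ) * x' x : ℝ) : EReal)

/-- The Fenchel conjugate `f* : X* → [-∞, +∞]`, `f*(x*) = sup_x (⟨x, x*⟩ - f x)`. -/
def conj (f : X → EReal) (x' : StrongDual ℝ X) : EReal :=
  ⨆ x : X, ((x' x : ℝ) : EReal) - f x

/-- The Fitzpatrick function of order `n` (used for `n ≥ 2`): the supremum over all
`(a₁, a₁*), …, (aₙ₋₁, aₙ₋₁*)` in the graph of `A` of
`⟨x, x*⟩ + ∑_{i=1}^{n-2} ⟨aᵢ₊₁ - aᵢ, aᵢ*⟩ + ⟨x - aₙ₋₁, aₙ₋₁*⟩ + ⟨a₁ - x, x*⟩`.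
Only the values of the sequence `a` at `1, …, n - 1` matter. -/
def fitzpatrick (A : X → Set (StrongDual ℝ X)) (n : ℕ) (p : X × StrongDual ℝ X) : EReal :=
  ⨆ a : ℕ → X × StrongDual ℝ X, ⨆ _ : ∀ i ∈ Finset.Icc 1 (n - 1), a i ∈ gra A,
    ((p.2 p.1 + ∑ i ∈ Finset.Icc 1 (n - 2), (a i).2 ((a (i + 1)).1 - (a i).1)
      + (a (n - 1)).2 (p.1 - (a (n - 1)).1) + p.2 ((a 1).1 - p.1) : ℝ) : EReal)

/-- `F_{A,∞} = sup_{n ≥ 2} F_{A,n}`. -/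
def fitzpatrickInfty (A : X → Set (StrongDual ℝ X)) (p : X × StrongDual ℝ X) : EReal :=
  ⨆ n : ℕ, ⨆ _ : 2 ≤ n, fitzpatrick A n p

/-- The direct sum `f ⊕ g : (x, x*) ↦ f x + g x*`. -/
def oplus (f : X → EReal) (g : StrongDual ℝ X → EReal) (p : X × StrongDual ℝ X) : EReal :=
  f p.1 + g p.2

/-- The identity of a real Hilbert space `H` as an operator `H ⇉ H*`, where `H` is identified with
`H*` through the Riesz isomorphism `x ↦ ⟪x, ·⟫`. -/
def hilbertId (H : Type*) [NormedAddCommGroup H] [InnerProductSpace ℝ H] [CompleteSpace H] :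
    H → Set (StrongDual ℝ H) :=
  ofMap (InnerProductSpace.toDual ℝ H)

end FitzpatrickOrder

end

/-!
For a monotone symmetric linear operator `A` write `q(x) = ½⟨x, Ax⟩ ≥ 0`. Symmetry gives
`⟨b - a, Aa⟩ = q(b) - q(a) - q(b - a)`, so the cyclic sum defining `F_{A,n}(x, x*)` telescopes:
with `m = n - 1`, steps `dᵢ = aᵢ₊₁ - aᵢ` and `a_{m+1} = x` it equals
`⟨a₁, x*⟩ + q(x) - q(a₁) - ∑ᵢ q(dᵢ)`. Since `q ≥ 0` is a quadratic form,
`∑ᵢ q(dᵢ) ≥ q(x - a₁) / m`, with equality for equally spaced points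
(`sum_chain_le`, `sum_chain_equally_spaced`). Hence `F_{A,n}(x, x*)` is the supremum over the
single point `a = a₁` of `⟨a, x*⟩ + q(x) - q(a) - q(x - a) / m`, and completing the square by
`a = x / n + ((n - 1) / n) e` turns this into
`(n-1)/n q(x) + ⟨x, x*⟩ / n + (n-1)/n (⟨e, x*⟩ - q(e))`, whose supremum over `e` is the claimed
formula (`fitzpatrick_ofMap_eq`).

By the Fenchel–Young inequality `⟨x, x*⟩ ≤ q(x) + q*(x*)`, every `F_{A,n}` is below `q ⊕ q*`, and
letting `n → ∞` gives equality of the supremum (`fitzpatrickInfty_ofMap_eq`). On a Hilbert space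
`q_Id = ½‖·‖²` is its own conjugate, again by completing the square (`conj_half_sq_norm`).
-/

namespace FitzpatrickOrder

section Form

variable {X : Type*} [NormedAddCommGroup X] [NormedSpace ℝ X]

/-- The quadratic form `x ↦ ½⟨x, Ax⟩` of a linear operator, as a real-valued function. -/
noncomputable def form (A : X →ₗ[ℝ] StrongDual ℝ X) (x : X) : ℝ :=
  1 / 2 * A x x

variable {A : X →ₗ[ℝ] StrongDual ℝ X}

lemma quad_ofMap (A : X →ₗ[ℝ] StrongDual ℝ X) (x : X) :
    quad (ofMap A) x = ((form A x : ℝ) : EReal) := by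
  simp [quad, ofMap, form]

lemma IsMonotone.form_nonneg (hA : IsMonotone (ofMap A)) (x : X) : 0 ≤ form A x := by
  have h := hA (x, A x) rfl (0, A 0) rfl
  simp only [map_zero, sub_zero] at h
  unfold form
  positivity

lemma IsSymmetric.apply_comm (hA : IsSymmetric (ofMap A)) (x y : X) : A x y = A y x :=
  hA (x, A x) rfl (y, A y) rfl

/-! ### Sums along chains -/

lemma sum_chain_eq (hA : ∀ x y, A x y = A y x) (b : ℕ → X) (m : ℕ) :
    ∑ i ∈ Finset.range m, A (b i) (b (i + 1) - b i) =
      form A (b m) - form A (b 0) - ∑ i ∈ Finset.range m, form A (b (i + 1) - b i) := by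
  induction m with
  | zero => simp
  | succ m ih =>
    rw [Finset.sum_range_succ, Finset.sum_range_succ, ih]
    simp only [form, map_sub, sub_apply]
    rw [hA (b (m + 1)) (b m)]
    ring

/-- Among chains with given endpoints the sum is largest when all steps are equal: the defect is
the sum of the values of the form at the deviations of the steps from their mean. -/
lemma sum_chain_le (hA : ∀ x y, A x y = A y x) (hq : ∀ x, 0 ≤ form A x) (b : ℕ → X) {m : ℕ}
    (hm : m ≠ 0) :
    ∑ i ∈ Finset.range m, A (b i) (b (i + 1) - b i) ≤
      form A (b m) - form A (b 0) - form A (b m - b 0) / m := by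
  have hm' : (m : ℝ) ≠ 0 := by exact_mod_cast hm
  rw [sum_chain_eq hA]
  set D := b m - b 0 with hD
  have h0 : 0 ≤ ∑ i ∈ Finset.range m, form A (b (i + 1) - b i - (1 / m : ℝ) • D) :=
    Finset.sum_nonneg fun i _ => hq _
  have h1 : ∀ d : X, form A (d - (1 / m : ℝ) • D) =
      form A d - 1 / m * A D d + (1 / m) ^ 2 * form A D := by
    intro d
    simp only [form, map_sub, map_smul, sub_apply, smul_apply, smul_eq_mul]
    rw [hA d D]
    ring
  have h2 : ∑ i ∈ Finset.range m, A D (b (i + 1) - b i) = 2 * form A D := by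
    rw [← map_sum, Finset.sum_range_sub, ← hD, form]
    ring
  simp only [h1, Finset.sum_add_distrib, Finset.sum_sub_distrib, ← Finset.mul_sum, h2,
    Finset.sum_const, Finset.card_range, nsmul_eq_mul] at h0
  have h3 : ∑ i ∈ Finset.range m, form A (b (i + 1) - b i) - 1 / m * (2 * form A D) +
      m * ((1 / m) ^ 2 * form A D) =
      ∑ i ∈ Finset.range m, form A (b (i + 1) - b i) - form A D / m := by
    field_simp
    ring
  linarith

lemma sum_chain_equally_spaced (hA : ∀ x y, A x y = A y x) (a x : X) {m : ℕ} (hm : m ≠ 0) :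
    ∑ i ∈ Finset.range m, A (a + (i / m : ℝ) • (x - a))
        (a + ((i + 1 : ℕ) / m : ℝ) • (x - a) - (a + (i / m : ℝ) • (x - a))) =
      form A x - form A a - form A (x - a) / m := by
  have hm' : (m : ℝ) ≠ 0 := by exact_mod_cast hm
  rw [sum_chain_eq hA fun i : ℕ => a + (i / m : ℝ) • (x - a)]
  have h : ∀ i : ℕ, a + ((i + 1 : ℕ) / m : ℝ) • (x - a) - (a + (i / m : ℝ) • (x - a)) =
      (1 / m : ℝ) • (x - a) := by
    intro i
    push_cast
    module
  simp only [h, div_self hm', Finset.sum_const, Finset.card_range, nsmul_eq_mul]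
  simp only [form, map_smul, smul_apply, smul_eq_mul, Nat.cast_zero, zero_div, zero_smul,
    add_zero, one_smul, add_sub_cancel]
  field_simp

/-! ### Fitzpatrick functions of finite order -/

/-- Appending `x` to the points `a₁, …, aₙ₋₁` (with `n = k + 2`, reindexed from `0`) absorbs the
boundary term `⟨x - aₙ₋₁, aₙ₋₁*⟩` into the sum. -/
lemma fitzpatrick_ofMap_eq_iSup_chain (A : X →ₗ[ℝ] StrongDual ℝ X) (k : ℕ) (x : X)
    (x' : StrongDual ℝ X) :
    fitzpatrick (ofMap A) (k + 2) (x, x') =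
      ⨆ b : ℕ → X, ⨆ _ : b (k + 1) = x,
        ((x' (b 0) + ∑ i ∈ Finset.range (k + 1), A (b i) (b (i + 1) - b i) : ℝ) : EReal) := by
  have hsum : ∀ f : ℕ → ℝ, ∑ i ∈ Finset.Icc 1 k, f i = ∑ i ∈ Finset.range k, f (i + 1) := by
    intro f
    rw [Finset.range_eq_Ico, Finset.sum_Ico_add' f 0 k 1]
    rfl
  apply le_antisymm
  · refine iSup₂_le fun a ha => ?_
    have ha' : ∀ i ≤ k, (a (i + 1)).2 = A (a (i + 1)).1 := fun i hi =>
      ha (i + 1) (Finset.mem_Icc.2 ⟨by omega, by omega⟩)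
    refine le_iSup₂_of_le (fun i => if i ≤ k then (a (i + 1)).1 else x) (by simp) ?_
    rw [EReal.coe_le_coe_iff, Finset.sum_range_succ]
    simp only [show k + 2 - 2 = k by omega, show k + 2 - 1 = k + 1 by omega, hsum]
    have : ∀ i ∈ Finset.range k, (a (i + 1)).2 ((a (i + 1 + 1)).1 - (a (i + 1)).1) =
        A (if i ≤ k then (a (i + 1)).1 else x)
          ((if i + 1 ≤ k then (a (i + 1 + 1)).1 else x) -
            (if i ≤ k then (a (i + 1)).1 else x)) := by
      intro i hi
      have hi := Finset.mem_range.1 hi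
      rw [if_pos hi.le, if_pos (Nat.succ_le_of_lt hi), ha' i hi.le]
    rw [Finset.sum_congr rfl this, ha' k le_rfl]
    simp only [zero_le, le_refl, if_true, map_sub, zero_add, Nat.not_succ_le_self, if_false]
    linarith
  · refine iSup₂_le fun b hb => ?_
    refine le_iSup₂_of_le (fun i => (b (i - 1), A (b (i - 1)))) (fun i _ => rfl) ?_
    rw [EReal.coe_le_coe_iff, Finset.sum_range_succ]
    simp only [show k + 2 - 2 = k by omega, show k + 2 - 1 = k + 1 by omega, hsum,
      Nat.add_sub_cancel, hb, map_sub]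
    simp only [Nat.sub_self]
    linarith

/-- The intermediate points of the chain can be eliminated, leaving a supremum over its starting
point, which is then substituted as `a = x / n + ((n - 1) / n) e`. -/
lemma fitzpatrick_ofMap_eq_iSup (hA : ∀ x y, A x y = A y x) (hq : ∀ x, 0 ≤ form A x)
    {n : ℕ} (hn : 2 ≤ n) (x : X) (x' : StrongDual ℝ X) :
    fitzpatrick (ofMap A) n (x, x') =
      ⨆ e : X, (((n - 1) / n * (x' e - form A e) +
        ((n - 1) / n * form A x + 1 / n * x' x) : ℝ) : EReal) := by
  obtain ⟨k, rfl⟩ := Nat.exists_eq_add_of_le' hn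
  rw [fitzpatrick_ofMap_eq_iSup_chain]
  have hk : (0 : ℝ) < k + 1 := by positivity
  have hk2 : (0 : ℝ) < k + 2 := by positivity
  have key : ∀ e : X, ∀ a : X, a = (1 / (k + 2) : ℝ) • x + ((k + 1) / (k + 2) : ℝ) • e →
      x' a + (form A x - form A a - form A (x - a) / ((k + 1 : ℕ) : ℝ)) =
        (((k + 2 : ℕ) : ℝ) - 1) / (k + 2 : ℕ) * (x' e - form A e) +
        ((((k + 2 : ℕ) : ℝ) - 1) / (k + 2 : ℕ) * form A x + 1 / (k + 2 : ℕ) * x' x) := by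
    rintro e a rfl
    simp only [form, map_add, map_sub, map_smul, add_apply, sub_apply,
      smul_apply, smul_eq_mul]
    rw [hA e x]
    push_cast
    field_simp
    ring
  apply le_antisymm
  · refine iSup₂_le fun b hb => ?_
    refine le_iSup_of_le (((k + 2) / (k + 1) : ℝ) • (b 0 - (1 / (k + 2) : ℝ) • x)) ?_
    rw [EReal.coe_le_coe_iff, ← key _ (b 0), ← hb]
    · gcongr
      exact sum_chain_le hA hq b k.succ_ne_zero
    · rw [smul_smul, div_mul_div_cancel₀ hk2.ne', div_self hk.ne']
      module
  · refine iSup_le fun e => ?_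
    set a : X := (1 / (k + 2) : ℝ) • x + ((k + 1) / (k + 2) : ℝ) • e with ha
    refine le_iSup₂_of_le (fun i : ℕ => a + (i / (k + 1 : ℕ) : ℝ) • (x - a)) ?_ ?_
    · have hk' : ((k + 1 : ℕ) : ℝ) ≠ 0 := by exact_mod_cast k.succ_ne_zero
      simp only [div_self hk', one_smul, add_sub_cancel]
    · rw [EReal.coe_le_coe_iff, ← key e a ha,
        sum_chain_equally_spaced hA a x k.succ_ne_zero]
      simp

/-- Increasing affine maps commute with suprema of real families in `EReal`, also when the
supremum is `⊤`. -/
lemma iSup_coe_mul_add {ι : Type*} [Nonempty ι] (v : ι → ℝ) {α : ℝ} (hα : 0 < α) (γ : ℝ) :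
    ⨆ e, ((α * v e + γ : ℝ) : EReal) = (α : EReal) * (⨆ e, (v e : EReal)) + (γ : EReal) := by
  have hbot : (⨆ e, (v e : EReal)) ≠ ⊥ := fun h =>
    EReal.coe_ne_bot _ (iSup_eq_bot.1 h (Classical.arbitrary ι))
  apply le_antisymm
  · refine iSup_le fun e => ?_
    push_cast
    gcongr
    exact le_iSup (fun e => (v e : EReal)) e
  · generalize hF : (⨆ e, ((α * v e + γ : ℝ) : EReal)) = F
    have hle : ∀ e, ((α * v e + γ : ℝ) : EReal) ≤ F := fun e => 
      hF ▸ le_iSup (fun e => ((α * v e + γ : ℝ) : EReal)) e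
    induction F with
    | bot => exact absurd (le_bot_iff.1 (hle (Classical.arbitrary ι))) (EReal.coe_ne_bot _)
    | top => exact le_top
    | coe f =>
      have hS : (⨆ e, (v e : EReal)) ≤ (((f - γ) / α : ℝ) : EReal) := by
        refine iSup_le fun e => ?_
        have := EReal.coe_le_coe_iff.1 (hle e)
        rw [EReal.coe_le_coe_iff, le_div_iff₀ hα]
        linarith
      lift (⨆ e, (v e : EReal)) to ℝ using
        ⟨fun h => EReal.coe_ne_top _ (top_le_iff.1 (h ▸ hS)), hbot⟩ with s
      rw [EReal.coe_le_coe_iff, le_div_iff₀ hα] at hS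
      norm_cast
      linarith

lemma conj_quad_ofMap (A : X →ₗ[ℝ] StrongDual ℝ X) (x' : StrongDual ℝ X) :
    conj (quad (ofMap A)) x' = ⨆ e : X, ((x' e - form A e : ℝ) : EReal) := by
  simp only [conj, quad_ofMap, EReal.coe_sub]

lemma fitzpatrick_ofMap_eq (hA : ∀ x y, A x y = A y x) (hq : ∀ x, 0 ≤ form A x)
    {n : ℕ} (hn : 2 ≤ n) (x : X) (x' : StrongDual ℝ X) :
    fitzpatrick (ofMap A) n (x, x') =
      ((((n : ℝ) - 1) / n : ℝ) : EReal) * quad (ofMap A) x +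
        ((((n : ℝ) - 1) / n : ℝ) : EReal) * conj (quad (ofMap A)) x' +
        ((1 / (n : ℝ) * x' x : ℝ) : EReal) := by
  have hn' : (2 : ℝ) ≤ n := by exact_mod_cast hn
  have hα : 0 < ((n : ℝ) - 1) / n := div_pos (by linarith) (by linarith)
  rw [fitzpatrick_ofMap_eq_iSup hA hq hn, iSup_coe_mul_add _ hα, conj_quad_ofMap, quad_ofMap,
    EReal.coe_add, EReal.coe_mul _ (form A x), ← add_assoc, add_comm (_ * iSup _)]

/-! ### The Fitzpatrick function of infinite order -/

lemma fitzpatrickInfty_ofMap_eq (hA : ∀ x y, A x y = A y x) (hq : ∀ x, 0 ≤ form A x) :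
    fitzpatrickInfty (ofMap A) = oplus (quad (ofMap A)) (conj (quad (ofMap A))) := by
  funext ⟨x, x'⟩
  have hFY : ((x' x - form A x : ℝ) : EReal) ≤ conj (quad (ofMap A)) x' := by
    rw [conj_quad_ofMap]
    exact le_iSup (fun e : X => ((x' e - form A e : ℝ) : EReal)) x
  have hF := fun (n : ℕ) (hn : 2 ≤ n) => fitzpatrick_ofMap_eq hA hq hn x x'
  simp only [fitzpatrickInfty, oplus]
  rw [quad_ofMap] at hF ⊢
  generalize conj (quad (ofMap A)) x' = S at hF hFY ⊢
  induction S with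
  | bot => exact absurd (le_bot_iff.1 hFY) (EReal.coe_ne_bot _)
  | top =>
    -- Already the function of order two is `⊤` here.
    rw [EReal.coe_add_top, eq_top_iff]
    refine le_iSup₂_of_le 2 le_rfl ?_
    rw [hF 2 le_rfl, EReal.coe_mul_top_of_pos (by norm_num), ← EReal.coe_mul,
      EReal.coe_add_top, EReal.top_add_coe]
  | coe c =>
    rw [EReal.coe_le_coe_iff] at hFY
    have hF' : ∀ n : ℕ, 2 ≤ n → fitzpatrick (ofMap A) n (x, x') =
        ((form A x + c - (form A x + c - x' x) / n : ℝ) : EReal) := by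
      intro n hn
      have : (n : ℝ) ≠ 0 := by positivity
      rw [hF n hn, ← EReal.coe_mul, ← EReal.coe_mul, ← EReal.coe_add, ← EReal.coe_add,
        EReal.coe_eq_coe_iff]
      field_simp
      ring
    rw [← EReal.coe_add]
    apply le_antisymm
    · refine iSup₂_le fun n hn => ?_
      rw [hF' n hn, EReal.coe_le_coe_iff]
      have : 0 ≤ (form A x + c - x' x) / n := div_nonneg (by linarith) n.cast_nonneg
      linarith
    · have hlim : Filter.Tendsto
          (fun n : ℕ => ((form A x + c - (form A x + c - x' x) / n : ℝ) : EReal))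
          Filter.atTop (nhds ((form A x + c : ℝ) : EReal)) := by
        rw [EReal.tendsto_coe]
        simpa using (tendsto_const_div_atTop_nhds_zero_nat (form A x + c - x' x)).const_sub
          (form A x + c)
      refine le_of_tendsto hlim ?_
      filter_upwards [Filter.eventually_ge_atTop 2] with n hn
      rw [← hF' n hn]
      exact le_iSup₂_of_le n hn le_rfl

end Form

/-! ### The identity of a Hilbert space -/

section Hilbert

variable {H : Type*} [NormedAddCommGroup H] [InnerProductSpace ℝ H] [CompleteSpace H]

/-- The Riesz isomorphism is conjugate-linear in Mathlib; over `ℝ` it agrees with the linear map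
`innerSL`. -/
lemma hilbertId_eq_ofMap_innerSL :
    hilbertId H = ofMap (innerSL ℝ : H →L[ℝ] StrongDual ℝ H).toLinearMap :=
  rfl

lemma quad_hilbertId : quad (hilbertId H) = fun x : H => ((1 / 2 * ‖x‖ ^ 2 : ℝ) : EReal) := by
  funext x
  rw [hilbertId_eq_ofMap_innerSL, quad_ofMap]
  simp [form]

lemma conj_half_sq_norm (x' : StrongDual ℝ H) :
    conj (fun x : H => ((1 / 2 * ‖x‖ ^ 2 : ℝ) : EReal)) x' =
      ((1 / 2 * ‖x'‖ ^ 2 : ℝ) : EReal) := by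
  obtain ⟨y, rfl⟩ := (InnerProductSpace.toDual ℝ H).surjective x'
  simp only [conj, InnerProductSpace.toDual_apply_apply, LinearIsometryEquiv.norm_map]
  apply le_antisymm
  · refine iSup_le fun e => ?_
    rw [← EReal.coe_sub, EReal.coe_le_coe_iff]
    nlinarith [norm_sub_sq_real y e, sq_nonneg ‖y - e‖]
  · refine le_iSup_of_le y ?_
    rw [← EReal.coe_sub, EReal.coe_le_coe_iff, real_inner_self_eq_norm_sq]
    linarith

end Hilbert

end FitzpatrickOrder

theorem corollary3p11 :
    (∀ (X : Type*) [NormedAddCommGroup X] [NormedSpace ℝ X] [CompleteSpace X],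
      FitzpatrickOrder.IsReflexive X →
      ∀ A : X →ₗ[ℝ] StrongDual ℝ X,
        FitzpatrickOrder.IsMaximalMonotone (FitzpatrickOrder.ofMap A) →
        FitzpatrickOrder.IsSymmetric (FitzpatrickOrder.ofMap A) →
        (∀ n : ℕ, 2 ≤ n → ∀ (x : X) (x' : StrongDual ℝ X),
          FitzpatrickOrder.fitzpatrick (FitzpatrickOrder.ofMap A) n (x, x') =
            ((((n : ℝ) - 1) / n : ℝ) : EReal) *
                FitzpatrickOrder.quad (FitzpatrickOrder.ofMap A) x +
              ((((n : ℝ) - 1) / n : ℝ) : EReal) *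
                FitzpatrickOrder.conj (FitzpatrickOrder.quad (FitzpatrickOrder.ofMap A)) x' +
              ((1 / (n : ℝ) * x' x : ℝ) : EReal)) ∧
        FitzpatrickOrder.fitzpatrickInfty (FitzpatrickOrder.ofMap A) =
          FitzpatrickOrder.oplus (FitzpatrickOrder.quad (FitzpatrickOrder.ofMap A))
            (FitzpatrickOrder.conj (FitzpatrickOrder.quad (FitzpatrickOrder.ofMap A)))) ∧
    (∀ (H : Type*) [NormedAddCommGroup H] [InnerProductSpace ℝ H] [CompleteSpace H],
        (∀ n : ℕ, 2 ≤ n → ∀ (x : H) (x' : StrongDual ℝ H),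
          FitzpatrickOrder.fitzpatrick (FitzpatrickOrder.hilbertId H) n (x, x') =
            ((((n : ℝ) - 1) / (2 * n) * ‖x‖ ^ 2 + ((n : ℝ) - 1) / (2 * n) * ‖x'‖ ^ 2 +
              1 / (n : ℝ) * x' x : ℝ) : EReal)) ∧
        FitzpatrickOrder.fitzpatrickInfty (FitzpatrickOrder.hilbertId H) =
          FitzpatrickOrder.oplus (fun x : H => ((1 / 2 * ‖x‖ ^ 2 : ℝ) : EReal))
            (fun x' : StrongDual ℝ H => ((1 / 2 * ‖x'‖ ^ 2 : ℝ) : EReal))) := by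
  refine ⟨?_, ?_⟩
  · intro X _ _ _ _ A hmax hsym
    have hA := hsym.apply_comm
    have hq := hmax.1.form_nonneg
    exact ⟨fun n hn x x' => FitzpatrickOrder.fitzpatrick_ofMap_eq hA hq hn x x',
      FitzpatrickOrder.fitzpatrickInfty_ofMap_eq hA hq⟩
  · intro H _ _ _
    have hA : ∀ x y : H, (innerSL ℝ : H →L[ℝ] StrongDual ℝ H).toLinearMap x y =
        (innerSL ℝ : H →L[ℝ] StrongDual ℝ H).toLinearMap y x :=
      fun x y => real_inner_comm y x
    have hq : ∀ x : H, 0 ≤ FitzpatrickOrder.form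
        (innerSL ℝ : H →L[ℝ] StrongDual ℝ H).toLinearMap x := fun x =>
      mul_nonneg (by norm_num) real_inner_self_nonneg
    constructor
    · intro n hn x x'
      have hn' : (n : ℝ) ≠ 0 := by positivity
      have h := FitzpatrickOrder.fitzpatrick_ofMap_eq hA hq hn x x'
      rw [← FitzpatrickOrder.hilbertId_eq_ofMap_innerSL, FitzpatrickOrder.quad_hilbertId,
        FitzpatrickOrder.conj_half_sq_norm] at h
      rw [h, ← EReal.coe_mul, ← EReal.coe_mul, ← EReal.coe_add, ← EReal.coe_add,
        EReal.coe_eq_coe_iff]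
      field_simp
    · have h := FitzpatrickOrder.fitzpatrickInfty_ofMap_eq hA hq
      rw [← FitzpatrickOrder.hilbertId_eq_ofMap_innerSL, FitzpatrickOrder.quad_hilbertId] at h
      rw [h]
      exact congrArg _ (funext FitzpatrickOrder.conj_half_sq_norm)
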